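/- Let $X \neq \{0\}$ be a real or complex Banach space, with closed unit ball $B_X$ and unit sphere $S_X$. For $x^* \in S_{X^*}$ and $\varepsilon > 0$ let \[S(x^*,\varepsilon) = \{x \in B_X : \operatorname{Re} x^*(x) > 1-\varepsilon\}.\] The space $X$ has the *local diameter 2 property +* (LD2P+) if for every $x^* \in S_{X^*}$, every $\varepsilon > 0$, every $\delta > 0$ and every $x \in S(x^*,\varepsilon) \cap S_X$ there exists $y \in S(x^*,\varepsilon)$ with $\|x-y\| > 2-\delta$. The space $X$ is *M-embedded* if $X^{***} = X^* \oplus_1 X^\perp$, that is, if $X^{***}$ is the direct sum of the canonical image of $X^*$ and the annihilator $X^\perp \subset X^{***}$ of the canonical image of $X$ in $X^{**}$, and $\|f+g\| = \|f\|+\|g\|$ for all $f \in X^*$ and $g \in X^\perp$. If $X$ is M-embedded, then $X$ does not have the LD2P+. -/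

import Mathlib

set_option maxSynthPendingDepth 3

namespace DiameterTwo

section Defs

variable {𝕜 : Type*} [RCLike 𝕜] {E : Type*} [NormedAddCommGroup E] [NormedSpace 𝕜 E]

/-- The slice `S(x*, ε) = {x ∈ B_E : Re x*(x) > 1 - ε}` of the closed unit ball of `E`.
Over the reals, the real part is the identity. -/
def slice (f : StrongDual 𝕜 E) (ε : ℝ) : Set E :=
  {x | ‖x‖ ≤ 1 ∧ 1 - ε < RCLike.re (f x)}

variable (𝕜 E) in
/-- The local diameter 2 property +. -/
def LD2PPlus : Prop :=
  ∀ f : StrongDual 𝕜 E, ‖f‖ = 1 → ∀ ε : ℝ, 0 < ε → ∀ δ : ℝ, 0 < δ →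
    ∀ x ∈ slice f ε, ‖x‖ = 1 → ∃ y ∈ slice f ε, 2 - δ < ‖x - y‖

/-- The annihilator `M^⊥ ⊆ F*` of a subspace `M` of `F`. -/
def annihilator {F : Type*} [AddCommMonoid F] [TopologicalSpace F] [Module 𝕜 F]
    (M : Submodule 𝕜 F) : Submodule 𝕜 (StrongDual 𝕜 F) where
  carrier := {f | ∀ x ∈ M, f x = 0}
  zero_mem' := fun _ _ => rfl
  add_mem' := fun {f g} hf hg x hx => by
    change f x + g x = 0
    rw [hf x hx, hg x hx, add_zero]
  smul_mem' := fun c f hf x hx => by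
    change c • f x = 0
    rw [hf x hx, smul_zero]

/-- `F = U ⊕₁ V`: the space `F` is the internal direct sum of the subspaces `U` and `V`, and
the norm of a sum of components is the sum of their norms. -/
def IsL1DirectSum {F : Type*} [NormedAddCommGroup F] [NormedSpace 𝕜 F]
    (U V : Submodule 𝕜 F) : Prop :=
  IsCompl U V ∧ ∀ u ∈ U, ∀ v ∈ V, ‖u + v‖ = ‖u‖ + ‖v‖

variable (𝕜 E) in
/-- The canonical image of `E` in its bidual. -/
noncomputable def canonicalImage : Submodule 𝕜 (StrongDual 𝕜 (StrongDual 𝕜 E)) :=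
  LinearMap.range (NormedSpace.inclusionInDoubleDual 𝕜 E).toLinearMap

variable (𝕜 E) in
/-- `E` is M-embedded: `E*** = E* ⊕₁ E^⊥`, where `E*` is identified with its canonical image
in `E***`, and `E^⊥` is the annihilator in `E***` of the canonical image of `E` in `E**`. -/
def IsMEmbedded : Prop :=
  IsL1DirectSum (canonicalImage 𝕜 (StrongDual 𝕜 E)) (annihilator (canonicalImage 𝕜 E))

end Defs

end DiameterTwo

open Filter Topology Metric NormedSpace

namespace DiameterTwo

section Roughness

variable {𝕜 : Type*} [RCLike 𝕜] {X : Type*} [NormedAddCommGroup X] [NormedSpace 𝕜 X]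

/-! LD2P+ makes the norm rough, so near every point lie points whose almost norming functionals
avoid a given `d` by `1 / 4`. In an M-embedded space, a weak-star limit in the third dual of norming
functionals has no `X^⊥` part, so limits of norming functionals stay in the closed span
(`IsMEmbedded.exists_norming_mem_closure_span`). A countable set `C`, stable under the roughness
perturbations, makes that span separable. Baire's theorem on `closure C` then gives a nonzero point
whose norming functionals avoid a countable dense set, a contradiction. -/

lemma re_apply_le_norm {h : StrongDual 𝕜 X} (hh : ‖h‖ ≤ 1) (x : X) : RCLike.re (h x) ≤ ‖x‖ :=
  (RCLike.re_le_norm _).trans (h.le_of_opNorm_le_of_le hh le_rfl |>.trans_eq (one_mul _))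

lemma neg_norm_le_re_apply {h : StrongDual 𝕜 X} (hh : ‖h‖ ≤ 1) (x : X) :
    -‖x‖ ≤ RCLike.re (h x) := by
  have := re_apply_le_norm hh (-x)
  simp only [map_neg, norm_neg] at this
  linarith

/-- The norm of a space with the LD2P+ is rough. -/
lemma LD2PPlus.exists_norm_add_norm_sub_ge [Nontrivial X] (H : LD2PPlus 𝕜 X) (x : X) {t : ℝ}
    (ht : 0 < t) :
    ∃ y : X, ‖y‖ ≤ 1 ∧ 2 * ‖x‖ + t ≤ ‖x + (t : 𝕜) • y‖ + ‖x - (t : 𝕜) • y‖ := by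
  obtain ⟨u, hu, hxu⟩ : ∃ u : X, ‖u‖ = 1 ∧ x = (‖x‖ : 𝕜) • u := by
    by_cases hx : x = 0
    · obtain ⟨v, hv⟩ := exists_ne (0 : X)
      exact ⟨((‖v‖ : 𝕜)⁻¹) • v, norm_smul_inv_norm hv, by simp [hx]⟩
    · refine ⟨((‖x‖ : 𝕜)⁻¹) • x, norm_smul_inv_norm hx, ?_⟩
      rw [smul_inv_smul₀]
      simpa using hx
  obtain ⟨f, hf, hfu⟩ := exists_dual_vector 𝕜 u (by simp [hu])
  rw [hu] at hfu
  have hpos : 0 < 2 * (‖x‖ + t) := by positivity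
  -- Testing `x + t y` with `f` and `x - t y` with `g` loses at most `δ (‖x‖ + 2t)` from `2‖x‖ +
  -- 2t`; this `δ` keeps the loss below `t`.
  set δ : ℝ := t / (2 * (‖x‖ + t)) with hδ
  have hδ0 : 0 < δ := by positivity
  have hδm : δ * (2 * (‖x‖ + t)) = t := div_mul_cancel₀ _ hpos.ne'
  obtain ⟨y, ⟨hy, hfy⟩, hxy⟩ := H f hf δ hδ0 δ hδ0 u ⟨hu.le, by simp [hfu, hδ0]⟩ hu
  obtain ⟨g, hg, hgu⟩ := exists_dual_vector'' 𝕜 (u - y)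
  have hgu' : RCLike.re (g u) - RCLike.re (g y) = ‖u - y‖ := by
    rw [← map_sub, ← map_sub, hgu, RCLike.ofReal_re]
  have h1 := re_apply_le_norm hg u
  have h2 := neg_norm_le_re_apply hg y
  have h3 := re_apply_le_norm hf.le (x + (t : 𝕜) • y)
  have h4 := re_apply_le_norm hg (x - (t : 𝕜) • y)
  rw [hxu, map_add, map_smul, map_smul, map_add, smul_eq_mul, smul_eq_mul, RCLike.re_ofReal_mul,
    RCLike.re_ofReal_mul, ← hxu, hfu, RCLike.ofReal_re] at h3
  rw [hxu, map_sub, map_smul, map_smul, map_sub, smul_eq_mul, smul_eq_mul, RCLike.re_ofReal_mul,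
    RCLike.re_ofReal_mul, ← hxu] at h4
  refine ⟨y, hy, ?_⟩
  have h5 : t * (1 - δ) ≤ t * RCLike.re (f y) := by gcongr
  have h6 : ‖x‖ * (1 - δ) ≤ ‖x‖ * RCLike.re (g u) := by gcongr; linarith
  have h7 : t * RCLike.re (g y) ≤ t * (-(1 - δ)) := by gcongr; linarith
  have h8 : 0 ≤ ‖x‖ * δ := by positivity
  nlinarith

/-- The points all of whose almost norming functionals stay away from `d`. -/
def normingAwayFrom (d : StrongDual 𝕜 X) : Set X :=
  {x | ∃ ε > 0, ∀ h : StrongDual 𝕜 X, ‖h‖ ≤ 1 → ‖x‖ - ε < RCLike.re (h x) → 1 / 4 ≤ ‖h - d‖}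

/-- A functional that norms a nearby point up to `ε / 2` norms `x` up to `ε`. -/
lemma isOpen_normingAwayFrom (d : StrongDual 𝕜 X) : IsOpen (normingAwayFrom d) := by
  refine Metric.isOpen_iff.2 fun x ⟨ε, hε, hx⟩ => ⟨ε / 4, by positivity, fun z hz => ?_⟩
  refine ⟨ε / 2, by positivity, fun h hh hz' => hx h hh ?_⟩
  rw [mem_ball, dist_eq_norm] at hz
  have h1 := re_apply_le_norm hh (z - x)
  have h2 := norm_sub_norm_le x z
  rw [norm_sub_rev] at h2
  rw [map_sub, map_sub] at h1
  linarith

/-- Otherwise functionals `f`, `g` close to `d` norm the two points up to `t / 4` each; as `‖f - g‖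
≤ 1 / 2`, the sum of the two norms stays below `2‖x‖ + t`. -/
lemma add_or_sub_mem_normingAwayFrom (d : StrongDual 𝕜 X) {x y : X} {t : ℝ} (ht : 0 < t)
    (hy : ‖y‖ ≤ 1) (hxy : 2 * ‖x‖ + t ≤ ‖x + (t : 𝕜) • y‖ + ‖x - (t : 𝕜) • y‖) :
    x + (t : 𝕜) • y ∈ normingAwayFrom d ∨ x - (t : 𝕜) • y ∈ normingAwayFrom d := by
  by_contra! hcon
  obtain ⟨h₁, h₂⟩ := hcon
  simp only [normingAwayFrom, Set.mem_ofPred_eq, not_exists, not_and, not_forall, not_le] at h₁ h₂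
  obtain ⟨f, hf, hfx, hfd⟩ := h₁ (t / 4) (by positivity)
  obtain ⟨g, hg, hgx, hgd⟩ := h₂ (t / 4) (by positivity)
  rw [map_add, map_smul, map_add, smul_eq_mul, RCLike.re_ofReal_mul] at hfx
  rw [map_sub, map_smul, map_sub, smul_eq_mul, RCLike.re_ofReal_mul] at hgx
  have h3 := re_apply_le_norm hf x
  have h4 := re_apply_le_norm hg x
  have h5 : ‖f - g‖ ≤ 1 / 2 := by
    have := norm_sub_le_norm_sub_add_norm_sub f d g
    rw [norm_sub_rev d g] at this
    linarith
  have h6 : RCLike.re ((f - g) y) ≤ 1 / 2 :=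
    (RCLike.re_le_norm _).trans (((f - g).le_of_opNorm_le_of_le h5 hy).trans_eq (mul_one _))
  rw [sub_apply, map_sub] at h6
  nlinarith

end Roughness

section MEmbedded

variable {𝕜 : Type*} [RCLike 𝕜] {X : Type*} [NormedAddCommGroup X] [NormedSpace 𝕜 X]

/-- A continuous functional that vanishes on a subspace but not at a given
point outside its closure. -/
lemma exists_dual_apply_ne_zero_of_notMem_closure (M : Submodule 𝕜 X) {x : X}
    (hx : x ∉ closure (M : Set X)) : ∃ Ψ : StrongDual 𝕜 X, (∀ m ∈ M, Ψ m = 0) ∧ Ψ x ≠ 0 := by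
  set N := M.topologicalClosure with hN
  have : IsClosed (N : Set X) := M.isClosed_topologicalClosure
  have hxN : N.mkQ x ≠ 0 := by
    rw [Submodule.mkQ_apply, Ne, Submodule.Quotient.mk_eq_zero]
    exact hx
  obtain ⟨g, -, hg⟩ := exists_dual_vector 𝕜 (N.mkQ x) (norm_ne_zero_iff.2 hxN)
  refine ⟨g.comp N.mkQL, fun m hm => ?_, ?_⟩
  · have : N.mkQ m = 0 := by
      rw [Submodule.mkQ_apply, Submodule.Quotient.mk_eq_zero]
      exact M.le_topologicalClosure hm
    change g (N.mkQ m) = 0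
    rw [this, map_zero]
  · change g (N.mkQ x) ≠ 0
    rw [hg]
    simpa using hxN

/-- A weak-star cluster point, in the third dual, of functionals in the unit ball. -/
lemma exists_tendsto_apply_ultrafilter {ι : Type*} (U : Ultrafilter ι) (h : ι → StrongDual 𝕜 X)
    (hh : ∀ i, ‖h i‖ ≤ 1) :
    ∃ F : StrongDual 𝕜 (StrongDual 𝕜 (StrongDual 𝕜 X)), ‖F‖ ≤ 1 ∧
      ∀ Ψ : StrongDual 𝕜 (StrongDual 𝕜 X), Tendsto (fun i => Ψ (h i)) U (𝓝 (F Ψ)) := by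
  have hc := WeakDual.isCompact_closedBall (𝕜 := 𝕜) (E := StrongDual 𝕜 (StrongDual 𝕜 X)) 0 1
  let J : ι → WeakDual 𝕜 (StrongDual 𝕜 (StrongDual 𝕜 X)) := fun i =>
    StrongDual.toWeakDual (inclusionInDoubleDual 𝕜 (StrongDual 𝕜 X) (h i))
  obtain ⟨F, hF, hUF⟩ := isCompact_iff_ultrafilter_le_nhds.1 hc (U.map J) (by
    rw [le_principal_iff]
    refine Filter.mem_map.2 (Filter.univ_mem' fun i => ?_)
    change inclusionInDoubleDual 𝕜 (StrongDual 𝕜 X) (h i) ∈ closedBall _ _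
    rw [mem_closedBall_zero_iff]
    exact (double_dual_bound 𝕜 _ _).trans (hh i))
  refine ⟨WeakDual.toStrongDual F, by simpa using hF, fun Ψ => ?_⟩
  exact ((WeakDual.eval_continuous Ψ).tendsto F).comp hUF

/-- In an M-embedded space, if `h q` norms `q` for every `q ∈ C`, then every nonzero point of the
closure of `C` is normed by a functional in the closed span of the functionals `h q`. -/
lemma IsMEmbedded.exists_norming_mem_closure_span (hX : IsMEmbedded 𝕜 X) {C : Set X}
    (h : X → StrongDual 𝕜 X) (hh : ∀ q, ‖h q‖ ≤ 1) (hq : ∀ q, h q q = ‖q‖) {z : X}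
    (hz : z ∈ closure C) (hz0 : z ≠ 0) :
    ∃ f : StrongDual 𝕜 X, ‖f‖ ≤ 1 ∧ f z = ‖z‖ ∧
      f ∈ closure (Submodule.span 𝕜 (h '' C) : Set (StrongDual 𝕜 X)) := by
  have : (𝓝[C] z).NeBot := mem_closure_iff_nhdsWithin_neBot.1 hz
  set U : Ultrafilter X := Ultrafilter.of (𝓝[C] z) with hUdef
  have hU : (U : Filter X) ≤ 𝓝[C] z := Ultrafilter.of_le _
  obtain ⟨F, hF, hlim⟩ := exists_tendsto_apply_ultrafilter U h hh
  have hUz : Tendsto (fun q : X => q) U (𝓝 z) := hU.trans nhdsWithin_le_nhds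
  have hFz : F (inclusionInDoubleDual 𝕜 X z) = ‖z‖ := by
    refine tendsto_nhds_unique (hlim _) ?_
    have h1 : Tendsto (fun q => h q q) U (𝓝 ((‖z‖ : ℝ) : 𝕜)) := by
      simp only [hq]
      exact (RCLike.continuous_ofReal.tendsto _).comp hUz.norm
    have h2 : Tendsto (fun q => h q (z - q)) U (𝓝 0) := by
      refine squeeze_zero_norm (fun q => ((h q).le_of_opNorm_le (hh q) _)) ?_
      have := ((tendsto_const_nhds (x := z)).sub hUz).norm
      simpa using this
    have := h1.add h2
    rw [add_zero] at this
    refine this.congr fun q => ?_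
    rw [← map_add, add_sub_cancel, dual_def]
  obtain ⟨hcompl, hnorm⟩ := hX
  obtain ⟨u, ⟨f, rfl⟩, v, hv, huv⟩ := Submodule.mem_sup.1
    (hcompl.sup_eq_top ▸ Submodule.mem_top : F ∈ canonicalImage 𝕜 (StrongDual 𝕜 X) ⊔
      annihilator (canonicalImage 𝕜 X))
  have hnF := hnorm _ ⟨f, rfl⟩ v hv
  rw [huv] at hnF
  have hfn : ‖(inclusionInDoubleDual 𝕜 (StrongDual 𝕜 X)).toLinearMap f‖ = ‖f‖ :=
    (inclusionInDoubleDualLi 𝕜 (E := StrongDual 𝕜 X)).norm_map f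
  rw [hfn] at hnF
  have hfz : f z = ‖z‖ := by
    have hvz : v (inclusionInDoubleDual 𝕜 X z) = 0 := hv _ ⟨z, rfl⟩
    rw [← hFz, ← huv, add_apply, hvz, add_zero]
    rfl
  have hf1 : 1 ≤ ‖f‖ := by
    have := f.le_opNorm z
    rw [hfz, RCLike.norm_ofReal, abs_norm] at this
    exact le_of_mul_le_mul_right (by linarith) (norm_pos_iff.2 hz0)
  -- The `ℓ₁` decomposition gives `‖f‖ + ‖v‖ = ‖F‖ ≤ 1`, while `‖f‖ ≥ 1`.
  have hv0 : v = 0 := norm_le_zero_iff.1 (by linarith)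
  refine ⟨f, by linarith [norm_nonneg v], hfz, ?_⟩
  -- `F` is now the image of `f`, so the `h q` converge weakly to `f` along `U`; Hahn–Banach puts
  -- `f` in the norm-closed span.
  by_contra hf
  obtain ⟨Ψ, hΨ, hΨf⟩ := exists_dual_apply_ne_zero_of_notMem_closure _ hf
  refine hΨf ?_
  have hFΨ : F Ψ = Ψ f := by
    rw [← huv, hv0, add_zero]
    rfl
  rw [← hFΨ]
  refine tendsto_nhds_unique (hlim Ψ) (tendsto_const_nhds.congr' ?_)
  have hC : C ∈ (U : Filter X) := hU self_mem_nhdsWithin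
  filter_upwards [hC] with q hqC
  exact (hΨ _ (Submodule.subset_span ⟨q, hqC, rfl⟩)).symm

end MEmbedded

/-- Given a family of self-maps indexed by a countable type, every point lies in a countable set
that is stable under all of them. -/
lemma exists_countable_stable {α ι : Type*} [Countable ι] (φ : ι → α → α) (a : α) :
    ∃ C : Set α, C.Countable ∧ a ∈ C ∧ ∀ x ∈ C, ∀ i, φ i x ∈ C :=
  ⟨Set.range fun l : List ι => l.foldr φ a, Set.countable_range _, ⟨[], rfl⟩, by
    rintro _ ⟨l, rfl⟩ i
    exact ⟨i :: l, rfl⟩⟩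

end DiameterTwo

open DiameterTwo in
theorem mainTheorem4 {𝕜 : Type*} [RCLike 𝕜] {X : Type*} [NormedAddCommGroup X]
    [NormedSpace 𝕜 X] [CompleteSpace X] [Nontrivial X]
    (hX : DiameterTwo.IsMEmbedded 𝕜 X) : ¬ DiameterTwo.LD2PPlus 𝕜 X := by
  intro H
  have ht : ∀ m : ℕ, (0 : ℝ) < 1 / (m + 1) := fun m => Nat.one_div_pos_of_nat
  choose y hy hxy using fun (x : X) (m : ℕ) => H.exists_norm_add_norm_sub_ge x (ht m)
  obtain ⟨x₀, hx₀⟩ := exists_ne (0 : X)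
  -- The Boolean selects the sign of the perturbation.
  obtain ⟨C, hC, hx₀C, hstable⟩ := exists_countable_stable
    (fun (i : ℕ × Bool) (x : X) =>
      bif i.2 then x + ((1 / (i.1 + 1) : ℝ) : 𝕜) • y x i.1
      else x - ((1 / (i.1 + 1) : ℝ) : 𝕜) • y x i.1) x₀
  have hadd : ∀ x ∈ C, ∀ m : ℕ, x + ((1 / (m + 1) : ℝ) : 𝕜) • y x m ∈ C :=
    fun x hx m => hstable x hx (m, true)
  have hsub : ∀ x ∈ C, ∀ m : ℕ, x - ((1 / (m + 1) : ℝ) : 𝕜) • y x m ∈ C :=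
    fun x hx m => hstable x hx (m, false)
  choose h hh hq using fun q : X => exists_dual_vector'' 𝕜 q
  have hsep : TopologicalSpace.IsSeparable
      (closure (Submodule.span 𝕜 (h '' C) : Set (StrongDual 𝕜 X))) :=
    ((hC.image h).isSeparable.span (R := 𝕜)).closure
  obtain ⟨D, hD, hDdense⟩ := hsep
  have : CompleteSpace (closure C) := isClosed_closure.completeSpace_coe
  -- Density: approximate by a point of `C`, then perturb it by at most `1 / (m + 1)` without
  -- leaving `C`.
  have hdense : Dense (⋂ d ∈ D, ((↑) : closure C → X) ⁻¹' normingAwayFrom d) := by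
    refine dense_biInter_of_isOpen
      (fun d _ => (isOpen_normingAwayFrom d).preimage continuous_subtype_val) hD fun d _ => ?_
    rw [Metric.dense_iff]
    rintro ⟨z, hz⟩ r hr
    obtain ⟨x, hxC, hxz⟩ := Metric.mem_closure_iff.1 hz (r / 2) (by positivity)
    obtain ⟨m, hm⟩ := exists_nat_one_div_lt (show 0 < r / 2 by positivity)
    have hsmall : ‖((1 / (m + 1) : ℝ) : 𝕜) • y x m‖ < r / 2 := by
      rw [norm_smul, RCLike.norm_ofReal, abs_of_pos (ht m)]
      exact (mul_le_of_le_one_right (ht m).le (hy x m)).trans_lt hm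
    rw [dist_comm] at hxz
    rcases add_or_sub_mem_normingAwayFrom d (ht m) (hy x m) (hxy x m) with h1 | h1
    · refine ⟨⟨_, subset_closure (hadd x hxC m)⟩, ?_, h1⟩
      rw [mem_ball, Subtype.dist_eq]
      refine (dist_triangle _ x z).trans_lt ?_
      rw [dist_eq_norm (x + _) x, add_sub_cancel_left]
      linarith
    · refine ⟨⟨_, subset_closure (hsub x hxC m)⟩, ?_, h1⟩
      rw [mem_ball, Subtype.dist_eq]
      refine (dist_triangle _ x z).trans_lt ?_
      rw [dist_eq_norm (x - _) x, sub_sub_cancel_left, norm_neg]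
      linarith
  obtain ⟨⟨z, hz⟩, hz0, hzD⟩ := hdense.inter_open_nonempty {p : closure C | (p : X) ≠ 0}
    (isOpen_ne.preimage continuous_subtype_val) ⟨⟨x₀, subset_closure hx₀C⟩, hx₀⟩
  obtain ⟨f, hf, hfz, hfspan⟩ := hX.exists_norming_mem_closure_span h hh hq hz hz0
  obtain ⟨d, hdD, hfd⟩ := Metric.mem_closure_iff.1 (hDdense hfspan) (1 / 4) (by norm_num)
  obtain ⟨ε, hε, hzε⟩ := Set.mem_iInter₂.1 hzD d hdD
  have := hzε f hf (by rw [hfz, RCLike.ofReal_re]; linarith)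
  rw [dist_eq_norm] at hfd
  linarith
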